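/- Let $K$ be a field and let $d_1,\dots,d_m$ be positive integers with $\gcd(d_1,\dots,d_m)=1$ (for instance, the minimal generators of a numerical semigroup with finite complement in $\mathbb{N}$). Let $S=\langle d_1,\dots,d_m\rangle=\{\sum_i a_id_i : a_i\in\mathbb{N}\}$ and let $K[S]=K[t^s : s\in S]$ be its semigroup ring, regarded as a graded module over $R=K[x_1,\dots,x_m]$, $\deg x_i=d_i$, through $x_i\mapsto t^{d_i}$. Let $$\cdots\to F_2\to F_1\to F_0\to K[S]\to 0,\qquad F_i=\bigoplus_j R(-j)^{\beta_{i,j}},$$ be a minimal graded free resolution of $K[S]$ over $R$ with all $F_i$ of finite rank, so that the $\beta_{i,j}$ are the graded Betti numbers of $K[S]$. Then $$\sum_{i=0}^{m-1}\sum_{j}(-1)^i\beta_{i,j}\,j^r=0\qquad\text{for every integer } r \text{ with } 0\le r\le m-2,$$ and $$\sum_{i=0}^{m-1}\sum_{j}(-1)^i\beta_{i,j}\,j^{m-1}=(-1)^{m-1}(m-1)!\,d_1d_2\cdots d_m,$$ where $j$ runs over the (finitely many) degrees with $\beta_{i,j}\neq 0$ and $0^0=1$. -/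

import Mathlib

noncomputable section

namespace NumericalSemigroup

open MvPolynomial

/-- The semigroup `⟨d₁, …, dₘ⟩ ⊆ ℕ`, i.e. all `∑ aᵢ dᵢ` with `aᵢ ∈ ℕ`. -/
def semigroup {m : ℕ} (d : Fin m → ℕ) : AddSubmonoid ℕ :=
  AddSubmonoid.closure (Set.range d)

/-- The semigroup ring `K[S] = K[t^s : s ∈ S]`. -/
abbrev SemigroupRing (K : Type*) [Field K] {m : ℕ} (d : Fin m → ℕ) : Type _ :=
  AddMonoidAlgebra K (semigroup d)

/-- The homomorphism `K[x₁, …, xₘ] → K[S]`, `xᵢ ↦ t^{dᵢ}`.  Through it `K[S]` is a module over the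
polynomial ring, which is graded by `deg xᵢ = dᵢ`. -/
def param (K : Type*) [Field K] {m : ℕ} (d : Fin m → ℕ) :
    MvPolynomial (Fin m) K →ₐ[K] SemigroupRing K d :=
  aeval fun i ↦ AddMonoidAlgebra.single
    (⟨d i, AddSubmonoid.subset_closure ⟨i, rfl⟩⟩ : semigroup d) (1 : K)

/-- A minimal graded free resolution
`⋯ → F₂ → F₁ → F₀ → K[S] → 0`
of the semigroup ring `K[S]` over `R = K[x₁, …, xₘ]`, `deg xᵢ = dᵢ`, with every
`Fᵢ = ⨁ₖ R(-deg i k)` of finite rank. No bound on the length is imposed.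
The differentials are given by matrices in the standard bases. -/
structure MinimalGradedFreeResolution (K : Type*) [Field K] {m : ℕ} (d : Fin m → ℕ) where
  /-- the rank of `Fᵢ` -/
  rank : ℕ → ℕ
  /-- the degrees of the basis elements of `Fᵢ` -/
  deg : (i : ℕ) → Fin (rank i) → ℕ
  /-- the images in `K[S]` of the basis elements of `F₀` -/
  gen : Fin (rank 0) → SemigroupRing K d
  /-- the matrix of the differential `Fᵢ₊₁ → Fᵢ` -/
  diff : (i : ℕ) → Matrix (Fin (rank i)) (Fin (rank (i + 1))) (MvPolynomial (Fin m) K)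
  /-- the augmentation `F₀ → K[S]` is homogeneous of degree `0` -/
  gen_mem : ∀ k, gen k ∈ AddMonoidAlgebra.gradeBy K (fun s : semigroup d ↦ (s : ℕ)) (deg 0 k)
  /-- the differentials are homogeneous of degree `0`: a nonzero entry in row `k` and column `l`
  is homogeneous of degree `deg (i + 1) l - deg i k` -/
  diff_homogeneous : ∀ i k l, diff i k l ≠ 0 →
    ∃ c, deg i k + c = deg (i + 1) l ∧ IsWeightedHomogeneous d (diff i k l) c
  /-- the augmentation is surjective -/
  surjective : ∀ f : SemigroupRing K d, ∃ x : Fin (rank 0) → MvPolynomial (Fin m) K,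
    ∑ k, param K d (x k) * gen k = f
  /-- exactness at `F₀` -/
  exact_zero : ∀ x : Fin (rank 0) → MvPolynomial (Fin m) K,
    ∑ k, param K d (x k) * gen k = 0 ↔ ∃ y, (diff 0).mulVec y = x
  /-- exactness at `Fᵢ₊₁` -/
  exact_succ : ∀ i (x : Fin (rank (i + 1)) → MvPolynomial (Fin m) K),
    (diff i).mulVec x = 0 ↔ ∃ y, (diff (i + 1)).mulVec y = x
  /-- minimality: the image of `Fᵢ₊₁` lies in `(x₁, …, xₘ) Fᵢ` -/
  minimal : ∀ i k l, constantCoeff (diff i k l) = 0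

namespace MinimalGradedFreeResolution

variable {K : Type*} [Field K] {m : ℕ} {d : Fin m → ℕ}

/-- The graded Betti number `β_{i,j}`: the number of copies of `R(-j)` in `Fᵢ`. -/
def betti (F : MinimalGradedFreeResolution K d) (i j : ℕ) : ℕ :=
  (Finset.univ.filter fun k ↦ F.deg i k = j).card

/-- The finitely many degrees `j` with `β_{i,j} ≠ 0`. -/
def degrees (F : MinimalGradedFreeResolution K d) (i : ℕ) : Finset ℕ :=
  Finset.univ.image (F.deg i)

theorem mem_degrees (F : MinimalGradedFreeResolution K d) (i j : ℕ) :
    j ∈ F.degrees i ↔ F.betti i j ≠ 0 := by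
  simp [degrees, betti, Finset.filter_eq_empty_iff]

end MinimalGradedFreeResolution

/-! Existence of a minimal graded free resolution. -/

section Existence

variable {K : Type*} [Field K] {m : ℕ} (d : Fin m → ℕ)

/-- The component of degree `e` of an element of `⨁ₖ R(-a k)`. -/
def comp {n : ℕ} (a : Fin n → ℕ) (e : ℕ) (x : Fin n → MvPolynomial (Fin m) K) :
    Fin n → MvPolynomial (Fin m) K :=
  fun k ↦ if a k ≤ e then weightedHomogeneousComponent d (e - a k) (x k) else 0

/-- Homogeneous elements of degree `b` of `⨁ₖ R(-a k)`. -/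
def IsHom {n : ℕ} (a : Fin n → ℕ) (b : ℕ) (x : Fin n → MvPolynomial (Fin m) K) : Prop :=
  ∀ k, x k ≠ 0 → ∃ c, a k + c = b ∧ IsWeightedHomogeneous d (x k) c

theorem whc_mul {p : MvPolynomial (Fin m) K} {c : ℕ} (hp : IsWeightedHomogeneous d p c)
    (r : MvPolynomial (Fin m) K) (n : ℕ) :
    weightedHomogeneousComponent d n (r * p) =
      if c ≤ n then weightedHomogeneousComponent d (n - c) r * p else 0 := by
  let _ := weightedGradedAlgebra K d
  have := DirectSum.coe_decompose_mul_of_right_mem (weightedHomogeneousSubmodule K d) (a := r)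
    (b := p) (i := c) n hp
  have key : ∀ (f : MvPolynomial (Fin m) K) (k : ℕ),
      ((DirectSum.decompose (weightedHomogeneousSubmodule K d) f k :
        weightedHomogeneousSubmodule K d k) : MvPolynomial (Fin m) K)
      = weightedHomogeneousComponent d k f := fun f k ↦ by
    exact weightedDecomposition.decompose'_apply K d f k
  rw [key, key] at this
  exact this

theorem isHom_comp {n : ℕ} (a : Fin n → ℕ) (e : ℕ) (x : Fin n → MvPolynomial (Fin m) K) :
    IsHom d a e (comp d a e x) := by
  intro k hk
  by_cases h : a k ≤ e
  · refine ⟨e - a k, by omega, ?_⟩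
    simp only [comp, if_pos h]
    exact weightedHomogeneousComponent_isWeightedHomogeneous _ _
  · simp [comp, h] at hk

theorem comp_sum {n : ℕ} (a : Fin n → ℕ) (e : ℕ) {ι : Type*} (s : Finset ι)
    (x : ι → Fin n → MvPolynomial (Fin m) K) :
    comp d a e (∑ i ∈ s, x i) = ∑ i ∈ s, comp d a e (x i) := by
  funext k
  by_cases h : a k ≤ e <;> simp [comp, h, Finset.sum_apply]

theorem comp_smul {n : ℕ} (a : Fin n → ℕ) (e : ℕ) {b : ℕ} {g : Fin n → MvPolynomial (Fin m) K}
    (hg : IsHom d a b g) (r : MvPolynomial (Fin m) K) :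
    comp d a e (r • g) = (if b ≤ e then weightedHomogeneousComponent d (e - b) r else 0) • g := by
  funext k
  by_cases h0 : g k = 0
  · simp [comp, h0]
  obtain ⟨c, hc, hh⟩ := hg k h0
  simp only [comp, Pi.smul_apply, smul_eq_mul, whc_mul d hh]
  by_cases h1 : a k ≤ e
  · by_cases h2 : b ≤ e
    · have h3 : c ≤ e - a k := by omega
      have h4 : e - a k - c = e - b := by omega
      simp [h1, h2, h3, h4]
    · have h3 : ¬ c ≤ e - a k := by omega
      simp [h2, h3]
  · have h2 : ¬ b ≤ e := by omega
    simp [h1, h2]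

theorem mem_span_comp {n : ℕ} (a : Fin n → ℕ) (x : Fin n → MvPolynomial (Fin m) K) :
    ∃ E : ℕ, x = ∑ e ∈ Finset.range E, comp d a e x := by
  have hN : ∀ k, ∃ N, ∀ e, N ≤ e → weightedHomogeneousComponent d e (x k) = 0 := fun k ↦
    ⟨weightedTotalDegree d (x k) + 1, fun e he ↦ weightedHomogeneousComponent_eq_zero _ _ he⟩
  choose N hN using hN
  refine ⟨∑ k, (a k + N k), ?_⟩
  funext k
  have hle : a k + N k ≤ ∑ k, (a k + N k) :=
    Finset.single_le_sum (f := fun k ↦ a k + N k) (fun _ _ ↦ Nat.zero_le _) (Finset.mem_univ k)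
  obtain ⟨M, hM⟩ := Nat.exists_eq_add_of_le (show a k ≤ ∑ k, (a k + N k) by omega)
  rw [Finset.sum_apply, hM, Finset.sum_range_add]
  have h1 : ∑ e ∈ Finset.range (a k), comp d a e x k = 0 :=
    Finset.sum_eq_zero fun e he ↦ by
      have : ¬ a k ≤ e := by simpa using he
      simp [comp, this]
  rw [h1, zero_add]
  conv_lhs => rw [← sum_weightedHomogeneousComponent d (x k)]
  rw [finsum_eq_sum_of_support_subset (s := Finset.range M)]
  · exact Finset.sum_congr rfl fun e _ ↦ by simp [comp]
  · intro e he
    by_contra hlt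
    refine he (hN k e ?_)
    simp only [Finset.coe_range, Set.mem_Iio, not_lt] at hlt
    omega

/-- A graded submodule of `⨁ₖ R(-a k)` contained in `(x₁, …, xₘ) ⨁ₖ R(-a k)`. -/
structure Stage (K : Type*) [Field K] {m : ℕ} (d : Fin m → ℕ) where
  n : ℕ
  a : Fin n → ℕ
  N : Submodule (MvPolynomial (Fin m) K) (Fin n → MvPolynomial (Fin m) K)
  comp_mem : ∀ e, ∀ x ∈ N, comp d a e x ∈ N
  le_max : ∀ x ∈ N, ∀ k, constantCoeff (x k) = 0

variable {d}

open Classical in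
theorem Stage.exists_gens (s : Stage K d) :
    ∃ p : ℕ, ∃ b : Fin p → ℕ, ∃ g : Fin p → Fin s.n → MvPolynomial (Fin m) K,
      (∀ l, IsHom d s.a (b l) (g l)) ∧
        Submodule.span (MvPolynomial (Fin m) K) (Set.range g) = s.N := by
  obtain ⟨T, hT⟩ : s.N.FG := IsNoetherian.noetherian s.N
  choose E hE using mem_span_comp d s.a (K := K)
  let U := T.biUnion fun x ↦ (Finset.range (E x)).image fun e ↦ (e, comp d s.a e x)
  have hU : ∀ u ∈ U, IsHom d s.a u.1 u.2 ∧ u.2 ∈ s.N := by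
    intro u hu
    simp only [U, Finset.mem_biUnion, Finset.mem_image] at hu
    obtain ⟨x, hx, e, -, rfl⟩ := hu
    exact ⟨isHom_comp d s.a e x, s.comp_mem e x (hT ▸ Submodule.subset_span hx)⟩
  let f := U.equivFin.symm
  refine ⟨U.card, fun l ↦ (f l).1.1, fun l ↦ (f l).1.2, fun l ↦ (hU _ (f l).2).1, ?_⟩
  apply le_antisymm
  · rw [Submodule.span_le]
    rintro _ ⟨l, rfl⟩
    exact (hU _ (f l).2).2
  · rw [← hT, Submodule.span_le]
    intro x hx
    rw [SetLike.mem_coe, hE x]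
    refine Submodule.sum_mem _ fun e he ↦ Submodule.subset_span ?_
    have hm : (e, comp d s.a e x) ∈ U := by
      simp only [U, Finset.mem_biUnion, Finset.mem_image]
      exact ⟨x, hx, e, he, rfl⟩
    exact ⟨f.symm ⟨_, hm⟩, by simp⟩

open Classical in
theorem Stage.exists_minimal_gens (hd : ∀ i, 0 < d i) (s : Stage K d) :
    ∃ p : ℕ, ∃ b : Fin p → ℕ, ∃ g : Fin p → Fin s.n → MvPolynomial (Fin m) K,
      (∀ l, IsHom d s.a (b l) (g l)) ∧
        Submodule.span (MvPolynomial (Fin m) K) (Set.range g) = s.N ∧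
        ∀ r : Fin p → MvPolynomial (Fin m) K, ∑ l, r l • g l = 0 →
          ∀ l, constantCoeff (r l) = 0 := by
  have hex := s.exists_gens
  obtain ⟨b, g, hg, hs⟩ := Nat.find_spec hex
  refine ⟨Nat.find hex, b, g, hg, hs, ?_⟩
  intro r hr l
  by_contra hc
  have hmin := @Nat.find_min _ _ hex
  generalize Nat.find hex = p at *
  have h1 := congrArg (comp d s.a (b l)) hr
  rw [comp_sum] at h1
  have h0 : comp d s.a (b l) (0 : Fin s.n → MvPolynomial (Fin m) K) = 0 := by
    funext k; simp [comp]
  rw [h0, Finset.sum_congr rfl fun j _ ↦ comp_smul d s.a (b l) (hg j) (r j),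
    ← Finset.add_sum_erase _ _ (Finset.mem_univ l)] at h1
  simp only [le_refl, if_true, Nat.sub_self] at h1
  rw [weightedHomogeneousComponent_zero _ fun i ↦ (hd i).ne'] at h1
  have hl : g l ∈ Submodule.span (MvPolynomial (Fin m) K) (g '' {j | j ≠ l}) := by
    have h2 : (C (coeff 0 (r l)) : MvPolynomial (Fin m) K) • g l ∈
        Submodule.span (MvPolynomial (Fin m) K) (g '' {j | j ≠ l}) := by
      rw [eq_neg_of_add_eq_zero_left h1]
      refine Submodule.neg_mem _ (Submodule.sum_mem _ fun j hj ↦ Submodule.smul_mem _ _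
        (Submodule.subset_span ⟨j, Finset.ne_of_mem_erase hj, rfl⟩))
    have h3 := Submodule.smul_mem _ (C (coeff 0 (r l))⁻¹ : MvPolynomial (Fin m) K) h2
    rw [smul_smul, ← C_mul, inv_mul_cancel₀ (show coeff 0 (r l) ≠ 0 from hc), C_1, one_smul] at h3
    exact h3
  obtain _ | q := p
  · exact l.elim0
  refine hmin (Nat.lt_succ_self q) ⟨b ∘ l.succAbove, g ∘ l.succAbove, fun j ↦ hg _, ?_⟩
  rw [← hs]
  apply le_antisymm
  · exact Submodule.span_mono (Set.range_comp_subset_range _ _)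
  · rw [Submodule.span_le]
    rintro _ ⟨j, rfl⟩
    have hset : Set.range (g ∘ l.succAbove) = g '' {j | j ≠ l} := by
      rw [Set.range_comp, Fin.range_succAbove]
      rfl
    rw [hset]
    by_cases hj : j = l
    · rw [hj]; exact hl
    · exact Submodule.subset_span ⟨j, hj, rfl⟩

/-- The map `⨁ₗ R(-b l) → ⨁ₖ R(-a k)` with the given columns. -/
def columns {n p : ℕ} (g : Fin p → Fin n → MvPolynomial (Fin m) K) :
    Matrix (Fin n) (Fin p) (MvPolynomial (Fin m) K) :=
  Matrix.of fun k l ↦ g l k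

theorem columns_mulVec {n p : ℕ} (g : Fin p → Fin n → MvPolynomial (Fin m) K)
    (r : Fin p → MvPolynomial (Fin m) K) : (columns g).mulVec r = ∑ l, r l • g l := by
  funext k
  simp [columns, Matrix.mulVec, dotProduct, Finset.sum_apply, mul_comm]

theorem Stage.exists_next (hd : ∀ i, 0 < d i) (s : Stage K d) :
    ∃ (t : Stage K d) (D : Matrix (Fin s.n) (Fin t.n) (MvPolynomial (Fin m) K)),
      (∀ k l, D k l ≠ 0 → ∃ c, s.a k + c = t.a l ∧ IsWeightedHomogeneous d (D k l) c) ∧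
      (∀ k l, constantCoeff (D k l) = 0) ∧
      (∀ x, x ∈ s.N ↔ ∃ y, D.mulVec y = x) ∧ (∀ x, x ∈ t.N ↔ D.mulVec x = 0) := by
  obtain ⟨p, b, g, hg, hs, hr⟩ := s.exists_minimal_gens hd
  refine ⟨⟨p, b, LinearMap.ker (Matrix.mulVecLin (columns g)), ?_, ?_⟩, columns g, ?_, ?_, ?_, ?_⟩
  · intro e x hx
    rw [LinearMap.mem_ker, Matrix.mulVecLin_apply, columns_mulVec] at hx ⊢
    have h1 := congrArg (comp d s.a e) hx
    rw [comp_sum, Finset.sum_congr rfl fun j _ ↦ comp_smul d s.a e (hg j) (x j)] at h1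
    refine Eq.trans h1 ?_
    funext k; simp [comp]
  · intro x hx
    rw [LinearMap.mem_ker, Matrix.mulVecLin_apply, columns_mulVec] at hx
    exact hr x hx
  · intro k l hkl
    exact hg l k hkl
  · intro k l
    exact s.le_max (g l) (hs ▸ Submodule.subset_span ⟨l, rfl⟩) k
  · intro x
    simp only [columns_mulVec, ← hs, Submodule.mem_span_range_iff_exists_fun]
  · intro x
    rw [LinearMap.mem_ker, Matrix.mulVecLin_apply]

theorem param_monomial (α : Fin m →₀ ℕ) (c : K) (s : semigroup d) :
    (param K d (monomial α c)).coeff s = if (s : ℕ) = Finsupp.weight d α then c else 0 := by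
  have h : ∃ t : semigroup d, (t : ℕ) = Finsupp.weight d α ∧
      param K d (monomial α c) = AddMonoidAlgebra.single t c := by
    refine ⟨α.sum fun i k ↦ k • (⟨d i, AddSubmonoid.subset_closure ⟨i, rfl⟩⟩ : semigroup d), ?_, ?_⟩
    · simp [Finsupp.sum, Finsupp.weight_apply]
    · rw [param, aeval_monomial]
      have : ∀ T : Finset (Fin m), (∏ i ∈ T, AddMonoidAlgebra.single
          (⟨d i, AddSubmonoid.subset_closure ⟨i, rfl⟩⟩ : semigroup d) (1 : K) ^ α i) =
          AddMonoidAlgebra.single (∑ i ∈ T, α i •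
            (⟨d i, AddSubmonoid.subset_closure ⟨i, rfl⟩⟩ : semigroup d)) (1 : K) := by
        intro T
        induction T using Finset.induction_on with
        | empty => simp [AddMonoidAlgebra.one_def]
        | insert i T hi ih =>
          rw [Finset.prod_insert hi, Finset.sum_insert hi, ih, AddMonoidAlgebra.single_pow,
            AddMonoidAlgebra.single_mul_single]
          simp
      rw [Finsupp.prod, this, Finsupp.sum, AddMonoidAlgebra.coe_algebraMap, Function.comp_apply,
        AddMonoidAlgebra.single_mul_single]
      simp
  obtain ⟨t, ht, h⟩ := h
  rw [h, AddMonoidAlgebra.coeff_single, Finsupp.single_apply, ← ht]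
  simp only [Subtype.ext_iff, eq_comm]

theorem param_component (e : ℕ) (f : MvPolynomial (Fin m) K) (s : semigroup d) :
    (param K d (weightedHomogeneousComponent d e f)).coeff s =
      if (s : ℕ) = e then (param K d f).coeff s else 0 := by
  induction f using MvPolynomial.induction_on' with
  | monomial α c =>
    by_cases h : Finsupp.weight d α = e
    · rw [(isWeightedHomogeneous_monomial d α c h).weightedHomogeneousComponent_same,
        param_monomial, h]
      split_ifs <;> rfl
    · rw [(isWeightedHomogeneous_monomial d α c rfl).weightedHomogeneousComponent_ne e (Ne.symm h),
        param_monomial]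
      by_cases h1 : (s : ℕ) = e
      · simp [h1, Ne.symm h]
      · simp [h1]
  | add p q hp hq =>
    rw [map_add, map_add, map_add, AddMonoidAlgebra.coeff_add, AddMonoidAlgebra.coeff_add,
      Finsupp.add_apply, Finsupp.add_apply, hp, hq]
    split_ifs <;> simp

theorem param_surjective : Function.Surjective (param K d) := by
  intro f
  induction f using AddMonoidAlgebra.induction_linear with
  | zero => exact ⟨0, map_zero _⟩
  | add f g hf hg =>
    obtain ⟨x, rfl⟩ := hf
    obtain ⟨y, rfl⟩ := hg
    exact ⟨x + y, map_add _ _ _⟩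
  | single s c =>
    have hw : ∃ α : Fin m →₀ ℕ, Finsupp.weight d α = (s : ℕ) := by
      refine AddSubmonoid.closure_induction
        (motive := fun n _ ↦ ∃ α : Fin m →₀ ℕ, Finsupp.weight d α = n) ?_ ?_ ?_ s.2
      · rintro _ ⟨i, rfl⟩
        exact ⟨Finsupp.single i 1, by simp [Finsupp.weight_single]⟩
      · exact ⟨0, map_zero _⟩
      · rintro _ _ _ _ ⟨α, rfl⟩ ⟨β, rfl⟩
        exact ⟨α + β, map_add _ _ _⟩
    obtain ⟨α, hα⟩ := hw
    refine ⟨monomial α c, ?_⟩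
    ext t
    rw [param_monomial, AddMonoidAlgebra.coeff_single, Finsupp.single_apply, hα]
    simp only [Subtype.ext_iff, eq_comm]

/-- The toric ideal, as a submodule of `F₀ = R`. -/
def Stage.init (hd : ∀ i, 0 < d i) : Stage K d where
  n := 1
  a := fun _ ↦ 0
  N := Submodule.comap
    (LinearMap.proj 0 : (Fin 1 → MvPolynomial (Fin m) K) →ₗ[MvPolynomial (Fin m) K]
      MvPolynomial (Fin m) K) (RingHom.ker (param K d))
  comp_mem := by
    intro e x hx
    simp only [Submodule.mem_comap, LinearMap.proj_apply, RingHom.mem_ker, comp, Nat.zero_le,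
      if_true, Nat.sub_zero] at hx ⊢
    ext s
    rw [param_component, hx]
    simp
  le_max := by
    intro x hx k
    simp only [Submodule.mem_comap, LinearMap.proj_apply, RingHom.mem_ker] at hx
    obtain rfl : k = 0 := Subsingleton.elim _ _
    have h := param_component (K := K) (d := d) 0 (x 0) 0
    rw [weightedHomogeneousComponent_zero _ fun i ↦ (hd i).ne', hx, ← monomial_zero',
      param_monomial] at h
    rw [constantCoeff_eq]
    simpa using h

theorem MinimalGradedFreeResolution.nonempty (K : Type*) [Field K] {m : ℕ} {d : Fin m → ℕ}
    (hd : ∀ i, 0 < d i) : Nonempty (MinimalGradedFreeResolution K d) := by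
  choose t D h1 h2 h3 h4 using Stage.exists_next (K := K) hd
  let S : ℕ → Stage K d := fun i ↦ Nat.rec (Stage.init hd) (fun _ s ↦ t s) i
  exact ⟨{
    rank := fun i ↦ (S i).n
    deg := fun i ↦ (S i).a
    gen := fun _ ↦ 1
    diff := fun i ↦ D (S i)
    gen_mem := by
      intro k s hs
      by_contra hne
      rw [Finsupp.mem_support_iff, AddMonoidAlgebra.one_def, AddMonoidAlgebra.coeff_single,
        Finsupp.single_apply] at hs
      refine hs (if_neg fun h ↦ hne ?_)
      rw [← h]
      rfl
    diff_homogeneous := fun i ↦ h1 (S i)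
    surjective := fun f ↦ by
      obtain ⟨x, rfl⟩ := param_surjective f
      refine ⟨fun _ ↦ x, ?_⟩
      change ∑ _k : Fin 1, _ = _
      simp
    exact_zero := fun x ↦ by
      refine Iff.trans ?_ (h3 (S 0) x)
      change ∑ k : Fin 1, param K d (x k) * 1 = 0 ↔ param K d (x (0 : Fin 1)) = 0
      rw [Fin.sum_univ_one, mul_one]
    exact_succ := fun i x ↦ (h4 (S i) x).symm.trans (h3 (S (i + 1)) x)
    minimal := fun i ↦ h2 (S i) }⟩

end Existence

end NumericalSemigroup

end

noncomputable section
namespace NumericalSemigroup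
open MvPolynomial

/-! ### Reduction of exact sequences modulo a regular element -/

section Reduction

variable {A B : Type*} [CommRing A] [CommRing B]

/-! Let `N(z)` be the alternating generating polynomial of the Betti numbers. Taking Euler
characteristics of the resolution in each degree gives `N(z) / ∏ (1 - z^dᵢ) = H(z)`, the Hilbert
series of `K[S]`. Since the gcd is one, `S` has finitely many gaps, so `(1 - z) H(z) = 1 - (1 - z)
G(z)` with `G` a polynomial. Hence `N = (1 - z)^(m-1) Q` with `Q(1) = ∏ dᵢ` (`exists_numerator_eq`).
The operator `z d/dz` multiplies `z^j` by `j`, so its `r`-th iterate on `N`, evaluated at 1, is the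
`r`-th power sum (`sum_betti_eq`). Each application removes at most one factor `1 - z`
(`exists_eulerOp_iterate_eq`): a zero remains for `r < m - 1`, and at `r = m - 1` only `(-1)^(m-1)
(m-1)! Q(1)` survives.

The resolution is not assumed finite, so truncating at `i < m` needs proof. Setting variables to
zero one at a time preserves minimality and exactness. Over `K` a minimal exact complex vanishes
beyond its start (`rank_eq_zero_of_exact`). The first variable is regular on `K[S]`, which improves
the bound from `m` to `m - 1`. -/

theorem map_mulVec_comp {p q : ℕ} (φ : A →+* B) (D : Matrix (Fin p) (Fin q) A) (x : Fin q → A) :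
    (D.map φ).mulVec (φ ∘ x) = φ ∘ D.mulVec x := by
  funext k
  simp [Matrix.mulVec, dotProduct, map_sum]

/-- Exactness is preserved modulo an element which is regular on the cokernel. -/
theorem exact_map_of_regular {p q r : ℕ} (φ : A →+* B) (hφ : Function.Surjective φ) (a : A)
    (ha : φ a = 0) (hker : ∀ x, φ x = 0 → ∃ y, x = a * y)
    (D : Matrix (Fin p) (Fin q) A) (E : Matrix (Fin q) (Fin r) A)
    (hex : ∀ x, D.mulVec x = 0 ↔ ∃ y, E.mulVec y = x)
    (hreg : ∀ w : Fin p → A, (∃ z, D.mulVec z = a • w) → ∃ v, D.mulVec v = w)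
    (x : Fin q → B) :
    (D.map φ).mulVec x = 0 ↔ ∃ y, (E.map φ).mulVec y = x := by
  constructor
  · intro hx
    obtain ⟨z, rfl⟩ : ∃ z : Fin q → A, φ ∘ z = x := by
      choose z hz using fun k ↦ hφ (x k)
      exact ⟨z, funext hz⟩
    rw [map_mulVec_comp] at hx
    choose w hw using fun k ↦ hker (D.mulVec z k) (congrFun hx k)
    -- The lift `z` is a cycle only modulo `a`. Regularity lets `a • v` correct it to a true cycle
    -- with the same reduction.
    obtain ⟨v, hv⟩ := hreg w ⟨z, funext hw⟩
    have h0 : D.mulVec (z - a • v) = 0 := by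
      rw [Matrix.mulVec_sub, Matrix.mulVec_smul, hv]
      exact sub_eq_zero.2 (funext hw)
    obtain ⟨u, hu⟩ := (hex _).1 h0
    refine ⟨φ ∘ u, ?_⟩
    rw [map_mulVec_comp, hu]
    funext k
    simp [ha]
  · rintro ⟨y, rfl⟩
    obtain ⟨z, rfl⟩ : ∃ z : Fin r → A, φ ∘ z = y := by
      choose z hz using fun k ↦ hφ (y k)
      exact ⟨z, funext hz⟩
    rw [map_mulVec_comp, map_mulVec_comp, (hex _).2 ⟨z, rfl⟩]
    funext k
    simp

/-- A regular element of the ring is regular on the cokernel of `E`, if `E` is followed by an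
exact map into a free module. -/
theorem regular_coker_of_exact {p q r : ℕ} (a : A) (ha : ∀ x : A, a * x = 0 → x = 0)
    (D : Matrix (Fin p) (Fin q) A) (E : Matrix (Fin q) (Fin r) A)
    (hex : ∀ x, D.mulVec x = 0 ↔ ∃ y, E.mulVec y = x) (w : Fin q → A)
    (hw : ∃ z, E.mulVec z = a • w) : ∃ v, E.mulVec v = w := by
  rw [← hex]
  have h := (hex _).2 hw
  rw [Matrix.mulVec_smul] at h
  exact funext fun k ↦ ha _ (congrFun h k)

end Reduction

/-! ### Length of a minimal free resolution -/

section Vanishing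

variable {K : Type*} [Field K]

/-- Setting the first variable equal to zero. -/
def killFirst (K : Type*) [Field K] (n : ℕ) :
    MvPolynomial (Fin (n + 1)) K →+* MvPolynomial (Fin n) K :=
  Polynomial.constantCoeff.comp (MvPolynomial.finSuccEquiv K n).toRingEquiv.toRingHom

theorem killFirst_apply (n : ℕ) (p : MvPolynomial (Fin (n + 1)) K) :
    killFirst K n p = (MvPolynomial.finSuccEquiv K n p).coeff 0 := rfl

theorem killFirst_surjective (n : ℕ) : Function.Surjective (killFirst K n) := fun q ↦
  ⟨(MvPolynomial.finSuccEquiv K n).symm (Polynomial.C q), by simp [killFirst_apply]⟩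

theorem killFirst_X_zero (n : ℕ) : killFirst K n (X 0) = 0 := by
  rw [killFirst_apply, finSuccEquiv_X_zero, Polynomial.coeff_X_zero]

theorem exists_eq_X_zero_mul (n : ℕ) (p : MvPolynomial (Fin (n + 1)) K)
    (hp : killFirst K n p = 0) : ∃ q, p = X 0 * q := by
  obtain ⟨q, hq⟩ := Polynomial.X_dvd_iff.2 hp
  refine ⟨(MvPolynomial.finSuccEquiv K n).symm q, (MvPolynomial.finSuccEquiv K n).injective ?_⟩
  rw [map_mul, finSuccEquiv_X_zero, AlgEquiv.apply_symm_apply]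
  exact hq

/-- Minimality passes to the reduced complex, as the induction on the number of variables requires.
-/
theorem constantCoeff_killFirst (n : ℕ) (p : MvPolynomial (Fin (n + 1)) K) :
    constantCoeff (killFirst K n p) = constantCoeff p := by
  rw [killFirst_apply, constantCoeff_eq, constantCoeff_eq, finSuccEquiv_coeff_coeff,
    Finsupp.cons_zero_zero]

/-- A minimal free resolution over a polynomial ring in `n` variables has length at most `n`. -/
theorem rank_eq_zero_of_exact : ∀ (n : ℕ) (r : ℕ → ℕ)
    (D : (i : ℕ) → Matrix (Fin (r i)) (Fin (r (i + 1))) (MvPolynomial (Fin n) K)),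
    (∀ i k l, constantCoeff (D i k l) = 0) →
    (∀ i x, (D i).mulVec x = 0 ↔ ∃ y, (D (i + 1)).mulVec y = x) →
    ∀ i, n < i → r i = 0 := by
  intro n
  induction n with
  | zero =>
    intro r D hmin hex i hi
    obtain ⟨i, rfl⟩ : ∃ j, i = j + 1 := ⟨i - 1, by omega⟩
    -- With no variables left every entry is a constant, so minimality kills the differentials;
    -- exactness then leaves no room for a nonzero vector.
    have hD : ∀ i, D i = 0 := fun i ↦ by
      ext1 k l
      rw [eq_C_of_isEmpty (D i k l), ← constantCoeff_eq, hmin, C_0]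
      rfl
    by_contra hr
    obtain ⟨y, hy⟩ := (hex i fun _ ↦ 1).1 (by rw [hD, Matrix.zero_mulVec])
    rw [hD, Matrix.zero_mulVec] at hy
    exact zero_ne_one (congrFun hy ⟨0, Nat.pos_of_ne_zero hr⟩)
  | succ n ih =>
    intro r D hmin hex i hi
    obtain ⟨i, rfl⟩ : ∃ j, i = j + 1 := ⟨i - 1, by omega⟩
    -- The term of index 0 is dropped: the cokernel of `D 0` may have `X 0`-torsion, while that of
    -- `D (i + 1)` embeds in a free module. This shift costs one step of length per variable.
    refine ih (fun i ↦ r (i + 1)) (fun i ↦ (D (i + 1)).map (killFirst K n)) ?_ ?_ i (by omega)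
    · intro i k l
      rw [Matrix.map_apply, constantCoeff_killFirst, hmin]
    · intro i
      exact exact_map_of_regular _ (killFirst_surjective n) (X 0) (killFirst_X_zero n)
        (exists_eq_X_zero_mul n) _ _ (hex (i + 1))
        (regular_coker_of_exact _ (fun x hx ↦ (mul_eq_zero.1 hx).resolve_left (X_ne_zero 0)) _ _
          (hex i))

/-- The projective dimension of `K[S]` is at most `m - 1`. -/
theorem MinimalGradedFreeResolution.rank_eq_zero {m : ℕ} {d : Fin m → ℕ}
    (F : MinimalGradedFreeResolution K d) (hm : 0 < m) (i : ℕ) (hi : m ≤ i) : F.rank i = 0 := by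
  obtain ⟨n, rfl⟩ : ∃ n, m = n + 1 := ⟨m - 1, by omega⟩
  have hX : ∀ f : SemigroupRing K d, param K d (X 0) * f = 0 → f = 0 := fun f hf ↦ by
    refine (mul_eq_zero.1 hf).resolve_left ?_
    rw [param, aeval_X, AddMonoidAlgebra.single_eq_zero]
    exact one_ne_zero
  -- No shift is needed here: the cokernel of `F.diff 0` is the domain `K[S]`, on which `X 0` acts
  -- as a nonzero element. Hence the bound uses `n = m - 1` variables.
  refine rank_eq_zero_of_exact n F.rank (fun i ↦ (F.diff i).map (killFirst K n)) ?_ ?_ i hi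
  · intro i k l
    rw [Matrix.map_apply, constantCoeff_killFirst, F.minimal]
  · intro i
    refine exact_map_of_regular _ (killFirst_surjective n) (X 0) (killFirst_X_zero n)
      (exists_eq_X_zero_mul n) _ _ (F.exact_succ i) ?_
    cases i with
    | zero =>
      intro w hw
      rw [← F.exact_zero] at hw ⊢
      refine hX _ ?_
      rw [← hw, Finset.mul_sum]
      exact Finset.sum_congr rfl fun k _ ↦ by
        rw [Pi.smul_apply, smul_eq_mul, map_mul, mul_assoc]
    | succ i =>
      exact regular_coker_of_exact _
        (fun x hx ↦ (mul_eq_zero.1 hx).resolve_left (X_ne_zero 0)) _ _ (F.exact_succ i)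

end Vanishing

/-! ### The Euler characteristic in each degree -/

/-- Rank–nullity telescopes along the exact sequence. Cutting it off at `n` leaves the rank of the
incoming map as an error term. -/
theorem alternating_sum_finrank {K : Type*} [Field K] (V : ℕ → Type*) [∀ i, AddCommGroup (V i)]
    [∀ i, Module K (V i)] [∀ i, FiniteDimensional K (V i)] {M : Type*} [AddCommGroup M]
    [Module K M] (g : V 0 →ₗ[K] M) (f : (i : ℕ) → V (i + 1) →ₗ[K] V i)
    (hg : LinearMap.ker g = LinearMap.range (f 0))
    (hf : ∀ i, LinearMap.ker (f i) = LinearMap.range (f (i + 1))) (n : ℕ) :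
    ∑ i ∈ Finset.range (n + 1), (-1 : ℤ) ^ i * (Module.finrank K (V i) : ℤ) =
      Module.finrank K (LinearMap.range g) +
        (-1) ^ n * Module.finrank K (LinearMap.range (f n)) := by
  induction n with
  | zero =>
    have h := LinearMap.finrank_range_add_finrank_ker g
    rw [hg] at h
    simp [← h]
  | succ n ih =>
    have h := LinearMap.finrank_range_add_finrank_ker (f n)
    rw [hf] at h
    rw [Finset.sum_range_succ, ih, ← h]
    push_cast
    ring

/-! ### Homogeneous pieces of graded free modules and their dimensions -/

section Piece

variable {K : Type*} [Field K] {m : ℕ} (d : Fin m → ℕ)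

/-- The coefficientwise form makes closure under addition and the monomial basis of each piece
accessible. -/
theorem isHom_iff {n : ℕ} (a : Fin n → ℕ) (e : ℕ) (x : Fin n → MvPolynomial (Fin m) K) :
    IsHom d a e x ↔ ∀ k α, coeff α (x k) ≠ 0 → a k + Finsupp.weight d α = e := by
  constructor
  · intro h k α hα
    obtain ⟨c, hc, hh⟩ := h k fun h0 ↦ hα (by rw [h0, coeff_zero])
    rw [hh hα, hc]
  · intro h k hk
    obtain ⟨α, hα⟩ := ne_zero_iff.1 hk
    refine ⟨Finsupp.weight d α, h k α hα, fun β hβ ↦ ?_⟩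
    have h1 := h k α hα
    have h2 := h k β hβ
    omega

theorem comp_eq_self {n : ℕ} {a : Fin n → ℕ} {e : ℕ} {x : Fin n → MvPolynomial (Fin m) K}
    (h : IsHom d a e x) : comp d a e x = x := by
  funext k
  by_cases h0 : x k = 0
  · simp [comp, h0]
  · obtain ⟨c, hc, hh⟩ := h k h0
    rw [comp, if_pos (by omega), show e - a k = c by omega, hh.weightedHomogeneousComponent_same]

/-- The component of degree `e` of `⨁ₖ R(-a k)`. -/
def piece (K : Type*) [Field K] {m : ℕ} (d : Fin m → ℕ) {n : ℕ} (a : Fin n → ℕ) (e : ℕ) :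
    Submodule K (Fin n → MvPolynomial (Fin m) K) where
  carrier := {x | IsHom d a e x}
  add_mem' {x y} hx hy := by
    rw [Set.mem_ofPred_eq, isHom_iff] at *
    intro k α h
    by_cases h1 : coeff α (x k) = 0
    · exact hy k α fun h2 ↦ h (by rw [Pi.add_apply, coeff_add, h1, h2, add_zero])
    · exact hx k α h1
  zero_mem' := fun k hk ↦ absurd rfl hk
  smul_mem' c x hx := by
    rw [Set.mem_ofPred_eq, isHom_iff] at *
    intro k α h
    exact hx k α fun h2 ↦ h (by rw [Pi.smul_apply, coeff_smul, h2, smul_zero])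

theorem mem_piece {n : ℕ} {a : Fin n → ℕ} {e : ℕ} {x : Fin n → MvPolynomial (Fin m) K} :
    x ∈ piece K d a e ↔ IsHom d a e x := Iff.rfl

theorem finite_weight_eq (hd : ∀ i, 0 < d i) (n : ℕ) : {α : Fin m →₀ ℕ | Finsupp.weight d α = n}.Finite :=
  (Finsupp.finite_of_nat_weight_le d (fun i ↦ (hd i).ne') n).subset fun _ h ↦ le_of_eq h

/-- The number of monomials of weighted degree `n`. -/
def monomialCount (n : ℕ) : ℕ := {α : Fin m →₀ ℕ | Finsupp.weight d α = n}.ncard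

/-- The basis monomials of degree `e` of `⨁ₖ R(-a k)`. -/
abbrev PieceIndex {n : ℕ} (a : Fin n → ℕ) (e : ℕ) : Type :=
  Σ k : Fin n, {α : Fin m →₀ ℕ // a k + Finsupp.weight d α = e}

theorem finite_fiber (hd : ∀ i, 0 < d i) (a e : ℕ) :
    Finite {α : Fin m →₀ ℕ // a + Finsupp.weight d α = e} :=
  Set.Finite.to_subtype (s := {α | a + Finsupp.weight d α = e}) <|
    (finite_weight_eq d hd (e - a)).subset fun α h ↦ by
      simp only [Set.mem_ofPred_eq] at h ⊢
      omega

theorem card_fiber (a e : ℕ) :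
    Nat.card {α : Fin m →₀ ℕ // a + Finsupp.weight d α = e} =
      if a ≤ e then monomialCount d (e - a) else 0 := by
  split_ifs with h
  · rw [monomialCount, ← Nat.card_coe_set_eq]
    refine Nat.card_congr (Equiv.subtypeEquivRight fun α ↦ ?_)
    simp only [Set.mem_ofPred_eq]
    omega
  · have : IsEmpty {α : Fin m →₀ ℕ // a + Finsupp.weight d α = e} :=
      ⟨fun α ↦ h (by have := α.2; omega)⟩
    exact Nat.card_of_isEmpty

/-- The coordinates with respect to the monomial basis. -/
def pieceCoeff {n : ℕ} (a : Fin n → ℕ) (e : ℕ) : piece K d a e →ₗ[K] (PieceIndex d a e → K) where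
  toFun x p := coeff p.2.1 (x.1 p.1)
  map_add' _ _ := rfl
  map_smul' _ _ := rfl

theorem pieceCoeff_bijective (hd : ∀ i, 0 < d i) {n : ℕ} (a : Fin n → ℕ) (e : ℕ) :
    Function.Bijective (pieceCoeff (K := K) d a e) := by
  classical
  constructor
  · rw [injective_iff_map_eq_zero]
    intro x hx
    ext k α
    by_contra h
    exact h (congrFun hx ⟨k, α, (isHom_iff d a e x.1).1 x.2 k α h⟩)
  · intro f
    have := fun k ↦ finite_fiber d hd (a k) e
    have := fun k ↦ Fintype.ofFinite {α : Fin m →₀ ℕ // a k + Finsupp.weight d α = e}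
    have hc : ∀ k β, coeff β (∑ α : {α : Fin m →₀ ℕ // a k + Finsupp.weight d α = e},
        monomial α.1 (f ⟨k, α⟩)) =
        if h : a k + Finsupp.weight d β = e then f ⟨k, β, h⟩ else 0 := by
      intro k β
      simp only [coeff_sum, coeff_monomial]
      split_ifs with h
      · rw [Finset.sum_eq_single ⟨β, h⟩]
        · simp
        · intro γ _ hγ
          exact if_neg fun h1 ↦ hγ (Subtype.ext h1)
        · simp
      · exact Finset.sum_eq_zero fun γ _ ↦ if_neg fun h1 : γ.1 = β ↦ h (h1 ▸ γ.2)
    refine ⟨⟨fun k ↦ ∑ α : {α : Fin m →₀ ℕ // a k + Finsupp.weight d α = e},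
      monomial α.1 (f ⟨k, α⟩), ?_⟩, ?_⟩
    · rw [mem_piece, isHom_iff]
      intro k β hβ
      by_contra h
      rw [hc, dif_neg h] at hβ
      exact hβ rfl
    · funext p
      exact (hc _ _).trans (dif_pos p.2.2)

theorem finiteDimensional_piece (hd : ∀ i, 0 < d i) {n : ℕ} (a : Fin n → ℕ) (e : ℕ) :
    FiniteDimensional K (piece K d a e) := by
  have := fun k ↦ finite_fiber d hd (a k) e
  exact Module.Finite.equiv (LinearEquiv.ofBijective _ (pieceCoeff_bijective d hd a e)).symm

theorem finrank_piece (hd : ∀ i, 0 < d i) {n : ℕ} (a : Fin n → ℕ) (e : ℕ) :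
    Module.finrank K (piece K d a e) =
      ∑ k, if a k ≤ e then monomialCount d (e - a k) else 0 := by
  have := fun k ↦ finite_fiber d hd (a k) e
  have := Fintype.ofFinite (PieceIndex d a e)
  rw [(LinearEquiv.ofBijective _ (pieceCoeff_bijective (K := K) d hd a e)).finrank_eq,
    Module.finrank_fintype_fun_eq_card, ← Nat.card_eq_fintype_card, Nat.card_sigma]
  exact Finset.sum_congr rfl fun k _ ↦ card_fiber d (a k) e

end Piece

/-! ### The resolution in a fixed degree -/

namespace MinimalGradedFreeResolution

variable {K : Type*} [Field K] {m : ℕ} {d : Fin m → ℕ} (F : MinimalGradedFreeResolution K d)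

/-- A differential of degree 0 commutes with the projection to degree `e`. This is what makes
exactness descend to each degree. -/
theorem diff_comp (i e : ℕ) (y : Fin (F.rank (i + 1)) → MvPolynomial (Fin m) K) :
    (F.diff i).mulVec (comp d (F.deg (i + 1)) e y) = comp d (F.deg i) e ((F.diff i).mulVec y) := by
  have h : F.diff i = columns fun l k ↦ F.diff i k l := rfl
  rw [h, columns_mulVec, columns_mulVec, comp_sum]
  exact Finset.sum_congr rfl fun l _ ↦
    (comp_smul d _ e (fun k hk ↦ F.diff_homogeneous i k l hk) (y l)).symm

theorem diff_mem_piece (i e : ℕ) (y : Fin (F.rank (i + 1)) → MvPolynomial (Fin m) K)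
    (hy : y ∈ piece K d (F.deg (i + 1)) e) : (F.diff i).mulVec y ∈ piece K d (F.deg i) e := by
  rw [← comp_eq_self d hy, diff_comp]
  exact isHom_comp _ _ _ _

/-- The differential in degree `e`. -/
def diffPiece (i e : ℕ) : piece K d (F.deg (i + 1)) e →ₗ[K] piece K d (F.deg i) e :=
  ((F.diff i).mulVecLin.restrictScalars K).restrict (F.diff_mem_piece i e)

theorem coe_diffPiece (i e : ℕ) (y : piece K d (F.deg (i + 1)) e) :
    (F.diffPiece i e y : Fin (F.rank i) → MvPolynomial (Fin m) K) = (F.diff i).mulVec y := rfl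

/-- Any preimage of a homogeneous element can be replaced by its component of degree `e`, so no
boundaries are lost in restricting. -/
theorem mem_range_diffPiece (i e : ℕ) (x : piece K d (F.deg i) e) :
    x ∈ LinearMap.range (F.diffPiece i e) ↔ ∃ y, (F.diff i).mulVec y = x := by
  constructor
  · rintro ⟨y, rfl⟩
    exact ⟨y, rfl⟩
  · rintro ⟨y, hy⟩
    refine ⟨⟨comp d (F.deg (i + 1)) e y, isHom_comp _ _ _ _⟩, Subtype.ext ?_⟩
    rw [coe_diffPiece, diff_comp, hy, comp_eq_self d x.2]

theorem ker_diffPiece (i e : ℕ) :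
    LinearMap.ker (F.diffPiece i e) = LinearMap.range (F.diffPiece (i + 1) e) := by
  ext x
  rw [mem_range_diffPiece, ← F.exact_succ, LinearMap.mem_ker, ← coe_diffPiece,
    ZeroMemClass.coe_eq_zero]

/-- The augmentation `F₀ → K[S]`. -/
def augmentation : (Fin (F.rank 0) → MvPolynomial (Fin m) K) →ₗ[K] SemigroupRing K d where
  toFun x := ∑ k, param K d (x k) * F.gen k
  map_add' x y := by simp [add_mul, Finset.sum_add_distrib]
  map_smul' c x := by simp [Finset.smul_sum]

theorem augmentation_apply (x : Fin (F.rank 0) → MvPolynomial (Fin m) K) :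
    F.augmentation x = ∑ k, param K d (x k) * F.gen k := rfl

theorem augmentation_mem (e : ℕ) (x : Fin (F.rank 0) → MvPolynomial (Fin m) K)
    (hx : IsHom d (F.deg 0) e x) :
    F.augmentation x ∈ AddMonoidAlgebra.gradeBy K (fun s : semigroup d ↦ (s : ℕ)) e := by
  rw [augmentation_apply]
  refine Submodule.sum_mem _ fun k _ ↦ ?_
  by_cases h0 : x k = 0
  · rw [h0, map_zero, zero_mul]
    exact Submodule.zero_mem _
  obtain ⟨c, hc, hh⟩ := hx k h0
  have h1 : param K d (x k) ∈
      AddMonoidAlgebra.gradeBy K (fun s : semigroup d ↦ (s : ℕ)) c := by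
    intro s hs
    by_contra hne
    rw [Finsupp.mem_support_iff, ← hh.weightedHomogeneousComponent_same, param_component,
      if_neg hne] at hs
    exact hs rfl
  have := AddMonoidAlgebra.gradeBy.gradedMonoid (R := K) (semigroup d).subtype
  rw [← hc, add_comm]
  exact SetLike.GradedMul.mul_mem (A := AddMonoidAlgebra.gradeBy K (semigroup d).subtype) h1
    (F.gen_mem k)

open Classical in
/-- The coefficient of `t ^ e`. -/
def semigroupCoeff (K : Type*) [Field K] {m : ℕ} (d : Fin m → ℕ) (e : ℕ) :
    SemigroupRing K d →ₗ[K] K where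
  toFun f := if h : e ∈ semigroup d then f.coeff ⟨e, h⟩ else 0
  map_add' f g := by split_ifs <;> simp
  map_smul' c f := by split_ifs <;> simp

/-- Degrees separate the elements of `S`, so one coefficient determines a homogeneous element. The
augmentation in degree `e` may therefore take values in `K`. -/
theorem eq_zero_of_semigroupCoeff {e : ℕ} {f : SemigroupRing K d}
    (hf : f ∈ AddMonoidAlgebra.gradeBy K (fun s : semigroup d ↦ (s : ℕ)) e)
    (h : semigroupCoeff K d e f = 0) : f = 0 := by
  ext s
  by_contra hs
  obtain rfl := hf s (Finsupp.mem_support_iff.2 hs)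
  exact hs ((dif_pos s.2).symm.trans h)

theorem semigroupCoeff_of_ne {e e' : ℕ} {f : SemigroupRing K d} (he : e' ≠ e)
    (hf : f ∈ AddMonoidAlgebra.gradeBy K (fun s : semigroup d ↦ (s : ℕ)) e') :
    semigroupCoeff K d e f = 0 := by
  classical
  change (if h : e ∈ semigroup d then f.coeff ⟨e, h⟩ else 0) = 0
  split_ifs with h
  · by_contra hs
    exact he (hf _ (Finsupp.mem_support_iff.2 hs)).symm
  · rfl

/-- The augmentation in degree `e`. -/
def augmentationPiece (e : ℕ) : piece K d (F.deg 0) e →ₗ[K] K :=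
  semigroupCoeff K d e ∘ₗ F.augmentation ∘ₗ (piece K d (F.deg 0) e).subtype

theorem ker_augmentationPiece (e : ℕ) :
    LinearMap.ker (F.augmentationPiece e) = LinearMap.range (F.diffPiece 0 e) := by
  ext x
  rw [mem_range_diffPiece, ← F.exact_zero, LinearMap.mem_ker]
  constructor
  · exact eq_zero_of_semigroupCoeff (F.augmentation_mem e x.1 x.2)
  · intro h
    change semigroupCoeff K d e (F.augmentation x.1) = 0
    rw [augmentation_apply, h, map_zero]

open Classical in
theorem finrank_range_augmentationPiece (e : ℕ) :
    Module.finrank K (LinearMap.range (F.augmentationPiece e)) =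
      if e ∈ semigroup d then 1 else 0 := by
  split_ifs with he
  · obtain ⟨y, hy⟩ := F.surjective (AddMonoidAlgebra.single ⟨e, he⟩ 1)
    obtain ⟨E, hE⟩ := mem_span_comp d (F.deg 0) y
    have h1 : semigroupCoeff K d e (F.augmentation y) = 1 := by
      rw [augmentation_apply, hy]
      exact (dif_pos he).trans (by simp)
    rw [hE, map_sum, map_sum] at h1
    -- Some homogeneous component of the preimage of `t^e` has a nonzero coefficient at `t^e`; only
    -- the component of degree `e` can.
    obtain ⟨e', -, hne⟩ := Finset.exists_ne_zero_of_sum_ne_zero (h1.trans_ne one_ne_zero)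
    obtain rfl : e' = e := by
      by_contra hee
      exact hne (semigroupCoeff_of_ne hee (F.augmentation_mem _ _ (isHom_comp _ _ _ _)))
    have hsurj : LinearMap.range (F.augmentationPiece e') = ⊤ := by
      refine LinearMap.range_eq_top.2 (LinearMap.surjective fun h ↦ hne ?_)
      exact LinearMap.congr_fun h ⟨comp d (F.deg 0) e' y, isHom_comp _ _ _ _⟩
    rw [hsurj, finrank_top, Module.finrank_self]
  · have h0 : F.augmentationPiece e = 0 := LinearMap.ext fun x ↦ dif_neg he
    rw [h0, LinearMap.range_zero, finrank_bot]

open Classical in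
/-- The Hilbert function of `K[S]`, computed from the resolution. -/
theorem alternating_sum_monomialCount (hd : ∀ i, 0 < d i) (hm : 0 < m) (e : ℕ) :
    ∑ i ∈ Finset.range m, (-1 : ℤ) ^ i *
      ∑ k, (if F.deg i k ≤ e then (monomialCount d (e - F.deg i k) : ℤ) else 0) =
      if e ∈ semigroup d then 1 else 0 := by
  obtain ⟨n, rfl⟩ : ∃ n, m = n + 1 := ⟨m - 1, by omega⟩
  have := fun i ↦ finiteDimensional_piece (K := K) d hd (F.deg i) e
  have h := alternating_sum_finrank (fun i ↦ piece K d (F.deg i) e) (F.augmentationPiece e)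
    (fun i ↦ F.diffPiece i e) (F.ker_augmentationPiece e) (fun i ↦ F.ker_diffPiece i e) n
  -- The error term is the rank of a map out of the degree-`e` piece of `F_m`, which is zero by the
  -- length bound.
  have h0 : Module.finrank K (LinearMap.range (F.diffPiece n e)) = 0 := by
    refine Nat.eq_zero_of_le_zero ((LinearMap.finrank_range_le _).trans (le_of_eq ?_))
    have : IsEmpty (Fin (F.rank (n + 1))) := by
      rw [F.rank_eq_zero hm (n + 1) le_rfl]
      infer_instance
    rw [finrank_piece d hd, Finset.univ_eq_empty, Finset.sum_empty]
  rw [h0, finrank_range_augmentationPiece] at h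
  simp only [finrank_piece d hd] at h
  push_cast at h
  rw [h]
  simp

end MinimalGradedFreeResolution

/-! ### Hilbert series -/

section HilbertSeries

variable {m : ℕ} (d : Fin m → ℕ)

/-- The geometric series in `X ^ a`: the Hilbert series of a polynomial ring in one variable of
degree `a`. -/
theorem one_sub_X_pow_mul_mk_dvd {a : ℕ} (ha : 0 < a) :
    (1 - PowerSeries.X ^ a) * PowerSeries.mk (fun n ↦ if a ∣ n then (1 : ℤ) else 0) = 1 := by
  ext n
  rw [sub_mul, one_mul, map_sub, PowerSeries.coeff_X_pow_mul', PowerSeries.coeff_mk,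
    PowerSeries.coeff_mk, PowerSeries.coeff_one]
  by_cases h : a ≤ n
  · have h0 : n ≠ 0 := by omega
    simp [h, h0, Nat.dvd_sub_iff_left h dvd_rfl]
  · by_cases h0 : n = 0
    · simp [h0, ha.ne']
    · have : ¬ a ∣ n := fun h1 ↦ h (Nat.le_of_dvd (Nat.pos_of_ne_zero h0) h1)
      simp [h, h0, this]

/-- A monomial `α` corresponds to the tuple of multiples `lᵢ = dᵢ αᵢ`, which is what the coefficient
of the product of geometric series counts. -/
theorem monomialCount_eq_coeff (hd : ∀ i, 0 < d i) (n : ℕ) :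
    (monomialCount d n : ℤ) = PowerSeries.coeff n
      (∏ i, PowerSeries.mk (fun n ↦ if d i ∣ n then (1 : ℤ) else 0)) := by
  have hw : ∀ α : Fin m →₀ ℕ, Finsupp.weight d α = ∑ i, d i * α i := fun α ↦ by
    rw [Finsupp.weight_apply, Finsupp.sum_fintype _ _ (by simp)]
    simp [mul_comm]
  rw [PowerSeries.coeff_prod]
  have h : ∀ l : Fin m →₀ ℕ, (∏ i, if d i ∣ l i then (1 : ℤ) else 0) =
      if ∀ i, d i ∣ l i then 1 else 0 := fun l ↦ by simp [Finset.prod_boole]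
  simp only [PowerSeries.coeff_mk, h, Finset.sum_boole]
  rw [monomialCount, Set.ncard_eq_toFinset_card _ (finite_weight_eq d hd n)]
  congr 1
  refine Finset.card_bij' (fun α _ ↦ Finsupp.equivFunOnFinite.symm fun i ↦ d i * α i)
    (fun l _ ↦ Finsupp.equivFunOnFinite.symm fun i ↦ l i / d i) ?_ ?_ ?_ ?_
  · intro α hα
    simp only [Set.Finite.mem_toFinset, Set.mem_ofPred_eq, hw] at hα
    simpa [Finset.mem_finsuppAntidiag] using hα
  · intro l hl
    simp only [Finset.mem_filter, Finset.mem_finsuppAntidiag] at hl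
    simp only [Set.Finite.mem_toFinset, Set.mem_ofPred_eq, hw]
    rw [← hl.1.1]
    exact Finset.sum_congr rfl fun i _ ↦ Nat.mul_div_cancel' (hl.2 i)
  · intro α _
    ext i
    simp [Nat.mul_div_cancel_left _ (hd i)]
  · intro l hl
    simp only [Finset.mem_filter] at hl
    ext i
    simp [Nat.mul_div_cancel' (hl.2 i)]

theorem prod_one_sub_mul_mk_monomialCount (hd : ∀ i, 0 < d i) :
    (∏ i, (1 - PowerSeries.X ^ d i)) * PowerSeries.mk (fun n ↦ (monomialCount d n : ℤ)) = 1 := by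
  have h : PowerSeries.mk (fun n ↦ (monomialCount d n : ℤ)) =
      ∏ i, PowerSeries.mk (fun n ↦ if d i ∣ n then (1 : ℤ) else 0) := by
    ext n
    rw [PowerSeries.coeff_mk, monomialCount_eq_coeff d hd]
  rw [h, ← Finset.prod_mul_distrib]
  exact Finset.prod_eq_one fun i _ ↦ one_sub_X_pow_mul_mk_dvd (hd i)

theorem exists_forall_ge_mem_semigroup (hgcd : Finset.univ.gcd d = 1) :
    ∃ N, ∀ n, N ≤ n → n ∈ semigroup d := by
  obtain ⟨N, hN⟩ := Nat.exists_mem_closure_of_ge (Set.range d)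
  refine ⟨N, fun n hn ↦ hN n hn ?_⟩
  have h : Nat.setGcd (Set.range d) ∣ Finset.univ.gcd d :=
    Finset.dvd_gcd fun i _ ↦ Nat.setGcd_dvd_of_mem ⟨i, rfl⟩
  exact (h.trans (hgcd ▸ dvd_rfl)).trans (one_dvd n)

open Classical in
theorem exists_gap_polynomial (hgcd : Finset.univ.gcd d = 1) :
    ∃ G : Polynomial ℤ, (1 - PowerSeries.X) *
      PowerSeries.mk (fun e ↦ if e ∈ semigroup d then (1 : ℤ) else 0) =
        1 - (1 - PowerSeries.X) * (G : PowerSeries ℤ) := by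
  obtain ⟨N, hN⟩ := exists_forall_ge_mem_semigroup d hgcd
  -- `G` is the generating polynomial of the gaps; truncating at `N` is harmless because there are
  -- none from `N` on.
  refine ⟨PowerSeries.trunc N (PowerSeries.mk fun e ↦ if e ∈ semigroup d then (0 : ℤ) else 1), ?_⟩
  suffices h : PowerSeries.mk (fun e ↦ if e ∈ semigroup d then (1 : ℤ) else 0) =
      PowerSeries.mk 1 - (PowerSeries.trunc N
        (PowerSeries.mk fun e ↦ if e ∈ semigroup d then (0 : ℤ) else 1) : PowerSeries ℤ) by
    rw [h, mul_sub, mul_comm _ (PowerSeries.mk 1), PowerSeries.mk_one_mul_one_sub_eq_one]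
  ext e
  rw [map_sub, Polynomial.coeff_coe, PowerSeries.coeff_trunc, PowerSeries.coeff_mk,
    PowerSeries.coeff_mk, PowerSeries.coeff_mk, Pi.one_apply]
  by_cases he : e < N
  · split_ifs <;> simp
  · simp [he, hN e (not_lt.1 he)]

variable {d} {K : Type*} [Field K]

/-- The numerator of the Hilbert series, `∑ᵢ (-1)ⁱ ∑ⱼ β_{i,j} zʲ`. -/
def MinimalGradedFreeResolution.numerator (F : MinimalGradedFreeResolution K d) : Polynomial ℤ :=
  ∑ i ∈ Finset.range m, (-1) ^ i * ∑ k, Polynomial.X ^ F.deg i k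

-- Reading the Euler characteristics of all degrees as coefficients turns them into one identity of
-- power series.
open Classical in
theorem MinimalGradedFreeResolution.numerator_mul (F : MinimalGradedFreeResolution K d)
    (hd : ∀ i, 0 < d i) (hm : 0 < m) :
    (F.numerator : PowerSeries ℤ) * PowerSeries.mk (fun n ↦ (monomialCount d n : ℤ)) =
      PowerSeries.mk (fun e ↦ if e ∈ semigroup d then (1 : ℤ) else 0) := by
  have hc : (F.numerator : PowerSeries ℤ) =
      ∑ i ∈ Finset.range m, (-1) ^ i * ∑ k, PowerSeries.X ^ F.deg i k := by
    simp only [numerator, ← Polynomial.coeToPowerSeries.ringHom_apply, map_sum, map_mul, map_pow,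
      map_neg, map_one]
    simp only [Polynomial.coeToPowerSeries.ringHom_apply, Polynomial.coe_X]
  ext e
  rw [PowerSeries.coeff_mk, ← F.alternating_sum_monomialCount hd hm e, hc, Finset.sum_mul, map_sum]
  refine Finset.sum_congr rfl fun i _ ↦ ?_
  have hi : ((-1) ^ i : PowerSeries ℤ) = PowerSeries.C ((-1) ^ i) := by simp
  rw [hi, mul_assoc, PowerSeries.coeff_C_mul, Finset.sum_mul, map_sum]
  congr 1
  refine Finset.sum_congr rfl fun k _ ↦ ?_
  rw [PowerSeries.coeff_X_pow_mul', PowerSeries.coeff_mk]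

/-- The numerator of the Hilbert series has a zero of order `m - 1` at `1`. -/
theorem MinimalGradedFreeResolution.exists_numerator_eq (F : MinimalGradedFreeResolution K d)
    (hd : ∀ i, 0 < d i) (hm : 0 < m) (hgcd : Finset.univ.gcd d = 1) :
    ∃ Q : Polynomial ℤ, F.numerator = (1 - Polynomial.X) ^ (m - 1) * Q ∧
      Q.eval 1 = ∏ i, (d i : ℤ) := by
  classical
  obtain ⟨G, hG⟩ := exists_gap_polynomial d hgcd
  -- The factor `1 - X` clears the remaining denominator of the Hilbert series, so the identity can
  -- be pulled back to polynomials.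
  have h1 : (1 - Polynomial.X) * F.numerator =
      (∏ i, (1 - Polynomial.X ^ d i)) * (1 - (1 - Polynomial.X) * G) := by
    apply Polynomial.coe_injective
    have h2 : ((∏ i, (1 - Polynomial.X ^ d i) : Polynomial ℤ) : PowerSeries ℤ) =
        ∏ i, (1 - PowerSeries.X ^ d i) := by
      rw [← Polynomial.coeToPowerSeries.ringHom_apply]
      simp
    have h3 : (F.numerator : PowerSeries ℤ) = (∏ i, (1 - PowerSeries.X ^ d i)) *
        PowerSeries.mk (fun e ↦ if e ∈ semigroup d then (1 : ℤ) else 0) := by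
      rw [← F.numerator_mul hd hm, mul_left_comm, prod_one_sub_mul_mk_monomialCount d hd, mul_one]
    rw [Polynomial.coe_mul, Polynomial.coe_mul, h2, h3, mul_left_comm]
    simp only [Polynomial.coe_sub, Polynomial.coe_one, Polynomial.coe_X, Polynomial.coe_mul]
    rw [hG]
  have hgeom : ∀ i, (1 - Polynomial.X ^ d i : Polynomial ℤ) =
      (1 - Polynomial.X) * ∑ j ∈ Finset.range (d i), Polynomial.X ^ j :=
    fun i ↦ (mul_neg_geom_sum _ _).symm
  -- Each `1 - X ^ dᵢ` yields one factor `1 - X` and a geometric sum worth `dᵢ` at 1; the gap factor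
  -- is 1 there. Of the `m` factors `1 - X`, one is cancelled against the left side.
  refine ⟨(∏ i, ∑ j ∈ Finset.range (d i), Polynomial.X ^ j) * (1 - (1 - Polynomial.X) * G), ?_, ?_⟩
  · have hne : (1 - Polynomial.X : Polynomial ℤ) ≠ 0 := fun h ↦ by
      simpa using congrArg (Polynomial.eval 0) h
    apply mul_left_cancel₀ hne
    rw [h1, Finset.prod_congr rfl fun i _ ↦ hgeom i, Finset.prod_mul_distrib, Finset.prod_const,
      Finset.card_univ, Fintype.card_fin, ← mul_assoc, ← mul_assoc, ← pow_succ',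
      Nat.sub_add_cancel hm]
  · simp [Polynomial.eval_prod, Polynomial.eval_finsetSum]

end HilbertSeries

/-! ### Power sums of exponents -/

/-- The Euler operator `z d/dz`. -/
def eulerOp : Polynomial ℤ →ₗ[ℤ] Polynomial ℤ :=
  LinearMap.mulLeft ℤ Polynomial.X ∘ₗ Polynomial.derivative

theorem eulerOp_apply (P : Polynomial ℤ) : eulerOp P = Polynomial.X * P.derivative := rfl

/-- Monomials are eigenvectors with eigenvalue their exponent, so iterating and evaluating at 1
produces power sums. -/
theorem eulerOp_iterate_X_pow (a r : ℕ) :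
    (eulerOp ^ r) (Polynomial.X ^ a) = (a : Polynomial ℤ) ^ r * Polynomial.X ^ a := by
  induction r with
  | zero => simp
  | succ r ih =>
    rw [pow_succ', Module.End.mul_apply, ih, eulerOp_apply, Polynomial.derivative_mul]
    have h : Polynomial.derivative ((a : Polynomial ℤ) ^ r) = 0 := by
      rw [← Nat.cast_pow, Polynomial.derivative_natCast]
    rw [h, Polynomial.derivative_X_pow]
    cases a with
    | zero => simp
    | succ a =>
      rw [Nat.add_sub_cancel, Polynomial.C_eq_natCast]
      ring

/-- One factor `1 - X` is spent. At 1 only the first term of the new cofactor survives, multiplying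
its value by `-(n + 1)`. -/
theorem eulerOp_one_sub_X_pow_mul (n : ℕ) (Q : Polynomial ℤ) :
    eulerOp ((1 - Polynomial.X) ^ (n + 1) * Q) = (1 - Polynomial.X) ^ n *
      (-((n + 1 : ℕ) : Polynomial ℤ) * Polynomial.X * Q +
        (1 - Polynomial.X) * Polynomial.X * Q.derivative) := by
  rw [eulerOp_apply, Polynomial.derivative_mul, Polynomial.derivative_pow, Nat.add_sub_cancel,
    Polynomial.C_eq_natCast, Polynomial.derivative_sub, Polynomial.derivative_one,
    Polynomial.derivative_X]
  ring

/-- Here `n` is the power of `1 - X` left over: `n > 0` gives the vanishing sums and `n = 0` the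
factorial. The induction peels off the innermost operator, hence the generalization over `Q`. -/
theorem exists_eulerOp_iterate_eq (n r : ℕ) (Q : Polynomial ℤ) :
    ∃ Q' : Polynomial ℤ,
      (eulerOp ^ r) ((1 - Polynomial.X) ^ (n + r) * Q) = (1 - Polynomial.X) ^ n * Q' ∧
      Q'.eval 1 = (-1) ^ r * ((n + r).descFactorial r : ℤ) * Q.eval 1 := by
  induction r generalizing Q with
  | zero => exact ⟨Q, by simp, by simp⟩
  | succ r ih =>
    obtain ⟨Q', h1, h2⟩ := ih (-((n + r + 1 : ℕ) : Polynomial ℤ) * Polynomial.X * Q +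
      (1 - Polynomial.X) * Polynomial.X * Q.derivative)
    refine ⟨Q', ?_, ?_⟩
    · rw [pow_succ, Module.End.mul_apply, ← h1, ← add_assoc, eulerOp_one_sub_X_pow_mul]
    · rw [h2, ← add_assoc, Nat.succ_descFactorial_succ]
      simp only [Polynomial.eval_add, Polynomial.eval_mul, Polynomial.eval_neg,
        Polynomial.eval_natCast, Polynomial.eval_X, Polynomial.eval_sub, Polynomial.eval_one]
      push_cast
      ring

theorem MinimalGradedFreeResolution.sum_betti_eq {K : Type*} [Field K] {m : ℕ} {d : Fin m → ℕ}
    (F : MinimalGradedFreeResolution K d) (r : ℕ) :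
    ∑ i ∈ Finset.range m, ∑ j ∈ F.degrees i, (-1 : ℤ) ^ i * (F.betti i j : ℤ) * (j : ℤ) ^ r =
      ((eulerOp ^ r) F.numerator).eval 1 := by
  rw [numerator, map_sum, Polynomial.eval_finsetSum]
  refine Finset.sum_congr rfl fun i _ ↦ ?_
  have h1 : ((-1) ^ i * ∑ k, Polynomial.X ^ F.deg i k : Polynomial ℤ) =
      (-1 : ℤ) ^ i • ∑ k, Polynomial.X ^ F.deg i k := by
    rw [zsmul_eq_mul]
    push_cast
    rfl
  rw [h1, map_smul, map_sum, Polynomial.eval_smul, Polynomial.eval_finsetSum, smul_eq_mul]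
  simp only [mul_assoc, ← Finset.mul_sum]
  congr 1
  simp only [eulerOp_iterate_X_pow, Polynomial.eval_mul, Polynomial.eval_pow,
    Polynomial.eval_natCast, Polynomial.eval_X, one_pow, mul_one]
  -- Grouping the basis elements by degree makes the fibre sizes the Betti numbers.
  rw [Finset.sum_comp (fun j : ℕ ↦ (j : ℤ) ^ r) (F.deg i)]
  exact Finset.sum_congr rfl fun j _ ↦ (nsmul_eq_mul _ _).symm

end NumericalSemigroup
end

/-! ### The power-sum identities -/

theorem theorem2p2 (K : Type*) [Field K] (m : ℕ) (d : Fin m → ℕ)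
    (hpos : ∀ i, 0 < d i) (hgcd : Finset.univ.gcd d = 1)
    (F : NumericalSemigroup.MinimalGradedFreeResolution K d) :
    (∀ r : ℕ, r + 2 ≤ m →
      ∑ i ∈ Finset.range m, ∑ j ∈ F.degrees i,
        (-1 : ℤ) ^ i * (F.betti i j : ℤ) * (j : ℤ) ^ r = 0) ∧
    ∑ i ∈ Finset.range m, ∑ j ∈ F.degrees i,
        (-1 : ℤ) ^ i * (F.betti i j : ℤ) * (j : ℤ) ^ (m - 1) =
      (-1 : ℤ) ^ (m - 1) * ((m - 1).factorial : ℤ) * ∏ i, (d i : ℤ) := by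
  have hm : 0 < m := by
    rcases Nat.eq_zero_or_pos m with rfl | hm
    -- The gcd of the empty family is 0, not 1.
    · simp at hgcd
    · exact hm
  obtain ⟨Q, hQ, hQ1⟩ := F.exists_numerator_eq hpos hm hgcd
  refine ⟨fun r hr ↦ ?_, ?_⟩
  -- The leftover exponent `m - 1 - r` is positive, so evaluation at 1 gives zero.
  · obtain ⟨Q', h1, -⟩ := NumericalSemigroup.exists_eulerOp_iterate_eq (m - 1 - r) r Q
    rw [Nat.sub_add_cancel (by omega)] at h1
    rw [F.sum_betti_eq, hQ, h1, Polynomial.eval_mul, Polynomial.eval_pow]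
    simp [show m - 1 - r ≠ 0 by omega]
  · obtain ⟨Q', h1, h2⟩ := NumericalSemigroup.exists_eulerOp_iterate_eq 0 (m - 1) Q
    rw [zero_add, pow_zero, one_mul] at h1
    rw [F.sum_betti_eq, hQ, h1, h2, hQ1, zero_add, Nat.descFactorial_self]
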